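/- Let $X$ be a normed vector lattice, i.e. a real vector lattice with a norm such that $|x|\le|y|$ implies $\|x\|\le\|y\|$. Let $C\subset X_+$ be a non-zero max-cone: $C\neq\{0\}$ is non-empty, $tx\in C$ for all $t\ge 0$ and $x\in C$, and the supremum $x\vee y$ (taken in $X$) belongs to $C$ for all $x,y\in C$. Let $A:C\to C$ be Lipschitz, positively homogeneous ($A(tx)=tA(x)$ for all $t\ge 0$, $x\in C$) and finite-suprema-preserving ($A(x\vee y)=Ax\vee Ay$ for all $x,y\in C$). Let $q(z)=\sum_{j=0}^{n}\alpha_j z^j$, with $n=\deg q$ ($n=0$ if $q=0$), be a polynomial with coefficients $\alpha_j\ge 0$, and put $$q_\vee(t)=\max_{0\le j\le n}\alpha_j t^j\quad(t\ge 0,\ t^0=1),\qquad q_\vee(A)x=\bigvee_{j=0}^{n}\alpha_j A^j x\quad(x\in C).$$ For a positively homogeneous map $B:C\to C$ that is bounded, i.e. $\|B\|:=\sup\{\|Bx\|/\|x\| : x\in C,\ x\ne 0\}<\infty$, let $r(B)=\lim_{k\to\infty}\|B^k\|^{1/k}$ be its Bonsall cone spectral radius. Then $A$ and $q_\vee(A)$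 are positively homogeneous and bounded, the limits $r(A)$ and $r(q_\vee(A))$ exist, and $$r(q_\vee(A))=q_\vee(r(A)).$$ -/

import Mathlib

open Filter Topology
open scoped NNReal

/-- A max-cone in an ordered real vector space `X` that is a lattice: a set `C ⊆ X₊` with `t C ⊆ C`
for all `t ≥ 0` that is closed under the binary suprema of `X`. Convexity is not required. -/
structure MaxCone (X : Type*) [AddCommGroup X] [Module ℝ X] [Lattice X] where
  carrier : Set X
  nonneg' : ∀ x ∈ carrier, 0 ≤ x
  smul_mem' : ∀ (t : ℝ), 0 ≤ t → ∀ x ∈ carrier, t • x ∈ carrier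
  sup_mem' : ∀ x ∈ carrier, ∀ y ∈ carrier, x ⊔ y ∈ carrier

namespace MaxCone

section Order

variable {X : Type*} [AddCommGroup X] [Module ℝ X] [Lattice X]

instance : SetLike (MaxCone X) X where
  coe := MaxCone.carrier
  coe_injective := by
    rintro ⟨_, _, _, _⟩ ⟨_, _, _, _⟩ h
    cases h
    rfl

/-- The order and the suprema of a max-cone are those of the ambient lattice. -/
instance (C : MaxCone X) : SemilatticeSup C :=
  Subtype.semilatticeSup fun {x y} hx hy => C.sup_mem' x hx y hy

/-- Multiplication of the elements of a cone by nonnegative reals. -/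
instance (C : MaxCone X) : SMul ℝ≥0 C where
  smul t x := ⟨(t : ℝ) • (x : X), C.smul_mem' t t.coe_nonneg x x.2⟩

/-- The cone contains a nonzero vector. -/
def IsNonzero (C : MaxCone X) : Prop := ∃ x ∈ C, x ≠ 0

/-- `A (t x) = t (A x)` for all `t ≥ 0`. -/
def PosHomogeneous {C : MaxCone X} (A : C → C) : Prop :=
  ∀ (t : ℝ≥0) (x : C), A (t • x) = t • A x

/-- `A (x ∨ y) = A x ∨ A y`. -/
def PreservesSup {C : MaxCone X} (A : C → C) : Prop :=
  ∀ x y : C, A (x ⊔ y) = A x ⊔ A y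

/-- The map `q_∨(A) x = ⋁_{j = 0}^{deg q} α_j A^j x` for `q = ∑ α_j z^j` with `α_j ≥ 0`. -/
def maxPolyMap {C : MaxCone X} (q : Polynomial ℝ≥0) (A : C → C) (x : C) : C :=
  (Finset.range (q.natDegree + 1)).sup' Finset.nonempty_range_add_one
    fun j => q.coeff j • A^[j] x

end Order

section Norm

variable {X : Type*} [NormedAddCommGroup X] [NormedSpace ℝ X] [Lattice X]

/-- The quotients `‖A x‖ / ‖x‖`, for `x ∈ C` nonzero, are bounded above. -/
def Bounded {C : MaxCone X} (A : C → C) : Prop :=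
  BddAbove {s : ℝ | ∃ x : C, (x : X) ≠ 0 ∧ s = ‖(A x : X)‖ / ‖(x : X)‖}

/-- `‖A‖ = sup {‖A x‖ / ‖x‖ : x ∈ C, x ≠ 0}`; meaningful when `A` is bounded and `C ≠ {0}`. -/
noncomputable def opNorm {C : MaxCone X} (A : C → C) : ℝ :=
  sSup {s : ℝ | ∃ x : C, (x : X) ≠ 0 ∧ s = ‖(A x : X)‖ / ‖(x : X)‖}

/-- The sequence `‖A^n‖^{1/n}`. -/
noncomputable def rootNorm {C : MaxCone X} (A : C → C) (n : ℕ) : ℝ :=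
  opNorm (A^[n]) ^ (1 / (n : ℝ))

/-- The Bonsall cone spectral radius `r(A) = lim_{n → ∞} ‖A^n‖^{1/n}`. -/
noncomputable def bonsallRadius {C : MaxCone X} (A : C → C) : ℝ :=
  limUnder atTop (rootNorm A)

end Norm

end MaxCone

/-- The maxpolynomial `q_∨(t) = max_{0 ≤ j ≤ deg q} α_j t^j` of `q = ∑ α_j z^j`, with `t ^ 0 = 1`. -/
noncomputable def maxPolyEval (q : Polynomial ℝ≥0) (t : ℝ) : ℝ :=
  (Finset.range (q.natDegree + 1)).sup' Finset.nonempty_range_add_one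
    fun j => (q.coeff j : ℝ) * t ^ j

/-! Lower bound: `α_j ^ k A ^ (j k) x ≤ q_∨(A) ^ k x`; take norms and `k`-th roots, using `r(A) ^ m
≤ ‖A ^ m‖`.

Upper bound: for `s > r(A)` some `M` gives `‖A ^ m‖ ≤ M s ^ m`. The vector `u = ∑_{m ≤ k deg q} s ^
(-m) A ^ m x` satisfies `A ^ m x ≤ s ^ m u` for these `m`, and this forces `q_∨(A) ^ k x ≤ q_∨(s) ^
k u` (`iterate_maxPolyMap_le`). Since `‖u‖ ≤ (k deg q + 1) M ‖x‖` grows only linearly in `k`, the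
prefactor disappears under `k`-th roots; then let `s ↓ r(A)`. -/

/-! ### Root limits of submultiplicative sequences. -/

theorem exists_le_mul_pow_of_submultiplicative {a : ℕ → ℝ} (ha : ∀ n, 0 ≤ a n)
    (hmul : ∀ m n, a (m + n) ≤ a m * a n) {s : ℝ} (hs : 0 < s) {n : ℕ} (hn : n ≠ 0)
    (h : a n ≤ s ^ n) : ∃ M : ℝ, 0 < M ∧ ∀ m, a m ≤ M * s ^ m := by
  have hterm : ∀ j ∈ Finset.range n, 0 ≤ a j / s ^ j := fun j _ => div_nonneg (ha j) (by positivity)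
  have hM : 0 < 1 + ∑ j ∈ Finset.range n, a j / s ^ j := by
    have := Finset.sum_nonneg hterm
    linarith
  -- The sum covers all indices below `n`; larger ones are lowered by `n` at a cost of `s ^ n`. The
  -- `1` ensures positivity.
  refine ⟨1 + ∑ j ∈ Finset.range n, a j / s ^ j, hM, fun m => ?_⟩
  induction m using Nat.strong_induction_on with
  | _ m ih =>
    rcases lt_or_ge m n with hm | hm
    · have h1 := Finset.single_le_sum hterm (Finset.mem_range.2 hm)
      rw [← div_le_iff₀ (by positivity)]
      linarith
    · obtain ⟨d, rfl⟩ := Nat.exists_eq_add_of_le' hm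
      calc a (d + n) ≤ a d * a n := hmul d n
        _ ≤ ((1 + ∑ j ∈ Finset.range n, a j / s ^ j) * s ^ d) * s ^ n :=
          mul_le_mul (ih d (by omega)) h (ha n) (by positivity)
        _ = _ := by rw [pow_add, mul_assoc]

theorem tendsto_mul_natCast_rpow_one_div {K : ℝ} (hK : 0 < K) :
    Tendsto (fun k : ℕ => (K * k) ^ (1 / (k : ℝ))) atTop (𝓝 1) := by
  have h1 : Tendsto (fun k : ℕ => K ^ (1 / (k : ℝ))) atTop (𝓝 1) := by
    have := (Real.continuousAt_const_rpow hK.ne').tendsto.comp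
      (tendsto_one_div_atTop_nhds_zero_nat (𝕜 := ℝ))
    simpa [Function.comp_def] using this
  have h2 : Tendsto (fun k : ℕ => (k : ℝ) ^ (1 / (k : ℝ))) atTop (𝓝 1) :=
    tendsto_rpow_div.comp tendsto_natCast_atTop_atTop
  have h3 := h1.mul h2
  rw [one_mul] at h3
  exact h3.congr fun k => (Real.mul_rpow hK.le k.cast_nonneg).symm

theorem rpow_one_div_le_of_le_mul_pow {a c s : ℝ} (ha : 0 ≤ a) (hc : 0 ≤ c) (hs : 0 ≤ s) {k : ℕ}
    (hk : k ≠ 0) (h : a ≤ c * s ^ k) : a ^ (1 / (k : ℝ)) ≤ c ^ (1 / (k : ℝ)) * s := by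
  calc a ^ (1 / (k : ℝ)) ≤ (c * s ^ k) ^ (1 / (k : ℝ)) :=
        Real.rpow_le_rpow ha h (by positivity)
    _ = c ^ (1 / (k : ℝ)) * s := by
        rw [Real.mul_rpow hc (by positivity), one_div, Real.pow_rpow_inv_natCast hs hk]

theorem le_of_tendsto_rpow_one_div {a : ℕ → ℝ} (ha : ∀ n, 0 ≤ a n) {r K s : ℝ}
    (hr : Tendsto (fun n : ℕ => a n ^ (1 / (n : ℝ))) atTop (𝓝 r)) (hK : 0 < K) (hs : 0 ≤ s)
    (h : ∀ k : ℕ, k ≠ 0 → a k ≤ K * k * s ^ k) : r ≤ s := by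
  have h1 := (tendsto_mul_natCast_rpow_one_div hK).mul_const s
  rw [one_mul] at h1
  refine le_of_tendsto_of_tendsto hr h1 ?_
  filter_upwards [eventually_ne_atTop 0] with k hk
  exact rpow_one_div_le_of_le_mul_pow (ha k) (by positivity) hs hk (h k hk)

/-- A nonnegative submultiplicative sequence has a root limit, which bounds it from below and governs
its growth from above. -/
theorem exists_tendsto_rpow_one_div_of_submultiplicative {a : ℕ → ℝ} (ha : ∀ n, 0 ≤ a n)
    (ha0 : a 0 = 1) (hmul : ∀ m n, a (m + n) ≤ a m * a n) :
    ∃ r : ℝ, 0 ≤ r ∧ Tendsto (fun n : ℕ => a n ^ (1 / (n : ℝ))) atTop (𝓝 r) ∧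
      (∀ n, r ^ n ≤ a n) ∧ ∀ s, r < s → ∃ M : ℝ, 0 < M ∧ ∀ m, a m ≤ M * s ^ m := by
  -- Index `0` is left out: `1 / 0 = 0` would contribute the spurious value `1` to the infimum.
  set S : Set ℝ := (fun n : ℕ => a n ^ (1 / (n : ℝ))) '' {n | n ≠ 0} with hS
  have hS0 : ∀ x ∈ S, 0 ≤ x := by
    rintro _ ⟨n, _, rfl⟩
    exact Real.rpow_nonneg (ha n) _
  have hbdd : BddBelow S := ⟨0, hS0⟩
  have hne : S.Nonempty := ⟨_, 1, one_ne_zero, rfl⟩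
  have hr : 0 ≤ sInf S := Real.sInf_nonneg hS0
  have hle : ∀ n : ℕ, n ≠ 0 → sInf S ≤ a n ^ (1 / (n : ℝ)) := fun n hn =>
    csInf_le hbdd ⟨n, hn, rfl⟩
  have hpow : ∀ n : ℕ, n ≠ 0 → (a n ^ (1 / (n : ℝ))) ^ n = a n := fun n hn => by
    rw [one_div, Real.rpow_inv_natCast_pow (ha n) hn]
  have hgrowth : ∀ s, sInf S < s → ∃ M : ℝ, 0 < M ∧ ∀ m, a m ≤ M * s ^ m := by
    intro s hs
    obtain ⟨_, ⟨n, hn, rfl⟩, hlt⟩ := exists_lt_of_csInf_lt hne hs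
    refine exists_le_mul_pow_of_submultiplicative ha hmul (hr.trans_lt hs) hn ?_
    rw [← hpow n hn]
    exact pow_le_pow_left₀ (Real.rpow_nonneg (ha n) _) hlt.le n
  refine ⟨sInf S, hr, ?_, fun n => ?_, hgrowth⟩
  · rw [tendsto_order]
    refine ⟨fun t ht => ?_, fun t ht => ?_⟩
    · filter_upwards [eventually_ne_atTop 0] with n hn
      exact ht.trans_le (hle n hn)
    · obtain ⟨s, hs, hst⟩ := exists_between ht
      obtain ⟨M, hM, hbound⟩ := hgrowth s hs
      have hs0 : 0 ≤ s := hr.trans hs.le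
      have h1 := (tendsto_mul_natCast_rpow_one_div hM).mul_const s
      rw [one_mul] at h1
      filter_upwards [eventually_ne_atTop 0, h1.eventually (gt_mem_nhds hst)] with n hn h2
      refine (rpow_one_div_le_of_le_mul_pow (ha n) (by positivity) hs0 hn ?_).trans_lt h2
      refine (hbound n).trans (mul_le_mul_of_nonneg_right ?_ (by positivity))
      exact le_mul_of_one_le_right hM.le (by exact_mod_cast Nat.one_le_iff_ne_zero.2 hn)
  · rcases eq_or_ne n 0 with rfl | hn
    · simp [ha0]
    · rw [← hpow n hn]
      exact pow_le_pow_left₀ hr (hle n hn) n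

theorem maxPolyEval_nonneg (q : Polynomial ℝ≥0) (s : ℝ) : 0 ≤ maxPolyEval q s :=
  (by simp : (0 : ℝ) ≤ (q.coeff 0 : ℝ) * s ^ 0).trans
    (Finset.le_sup' (fun j => (q.coeff j : ℝ) * s ^ j) (by simp))

theorem coeff_mul_pow_le_maxPolyEval (q : Polynomial ℝ≥0) (s : ℝ) {j : ℕ}
    (hj : j ∈ Finset.range (q.natDegree + 1)) : (q.coeff j : ℝ) * s ^ j ≤ maxPolyEval q s :=
  Finset.le_sup' (fun j => (q.coeff j : ℝ) * s ^ j) hj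

theorem continuous_maxPolyEval (q : Polynomial ℝ≥0) : Continuous (maxPolyEval q) := by
  unfold maxPolyEval
  exact Continuous.finset_sup'_apply _ fun j _ => by fun_prop

theorem norm_le_norm_of_nonneg_of_le {X : Type*} [NormedAddCommGroup X] [Lattice X]
    [IsOrderedAddMonoid X] [HasSolidNorm X] {x y : X} (hx : 0 ≤ x) (h : x ≤ y) : ‖x‖ ≤ ‖y‖ :=
  norm_le_norm_of_abs_le_abs (by rwa [abs_of_nonneg hx, abs_of_nonneg (hx.trans h)])

namespace MaxCone

/-! ### Order estimates for iterates on a max-cone. -/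

section Order

variable {X : Type*} [AddCommGroup X] [Module ℝ X] [Lattice X] {C : MaxCone X}

theorem coe_nnreal_smul (t : ℝ≥0) (x : C) : ((t • x : C) : X) = (t : ℝ) • (x : X) := rfl

theorem coe_nonneg (x : C) : (0 : X) ≤ x := C.nonneg' x x.2

theorem PosHomogeneous.iterate {A : C → C} (hA : PosHomogeneous A) (n : ℕ) :
    PosHomogeneous A^[n] := by
  induction n with
  | zero => exact fun _ _ => rfl
  | succ n ih => exact fun t x => by rw [Function.iterate_succ_apply, hA, ih,
      Function.iterate_succ_apply]

theorem PreservesSup.iterate {A : C → C} (hA : PreservesSup A) (n : ℕ) :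
    PreservesSup A^[n] := by
  induction n with
  | zero => exact fun _ _ => rfl
  | succ n ih => exact fun x y => by simp only [Function.iterate_succ_apply]; rw [hA, ih]

theorem PreservesSup.monotone {A : C → C} (hA : PreservesSup A) : Monotone A := fun x y hxy => by
  rw [← sup_eq_right, ← hA, sup_eq_right.2 hxy]

theorem PosHomogeneous.coe_map_eq_zero {A : C → C} (hA : PosHomogeneous A) {x : C}
    (hx : (x : X) = 0) : (A x : X) = 0 := by
  have h : (0 : ℝ≥0) • x = x := Subtype.ext (by simp [coe_nnreal_smul, hx])
  rw [← h, hA, coe_nnreal_smul, NNReal.coe_zero, zero_smul]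

theorem iterate_maxPolyMap {A : C → C} (hhom : PosHomogeneous A) (hsup : PreservesSup A)
    (q : Polynomial ℝ≥0) (m : ℕ) (x : C) :
    A^[m] (maxPolyMap q A x) =
      (Finset.range (q.natDegree + 1)).sup' Finset.nonempty_range_add_one
        fun j => q.coeff j • A^[m + j] x := by
  unfold maxPolyMap
  rw [Finset.apply_sup'_eq_sup'_comp _ A^[m] (hsup.iterate m)]
  congr 1
  funext j
  rw [Function.comp_apply, hhom.iterate m, Function.iterate_add_apply]

theorem coeff_smul_iterate_le_maxPolyMap (q : Polynomial ℝ≥0) (A : C → C) (x : C) {j : ℕ}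
    (hj : j ∈ Finset.range (q.natDegree + 1)) : q.coeff j • A^[j] x ≤ maxPolyMap q A x :=
  Finset.le_sup' (fun j => q.coeff j • A^[j] x) hj

variable [IsOrderedModule ℝ X]

theorem nnreal_smul_mono {t : ℝ≥0} {x y : C} (h : x ≤ y) : t • x ≤ t • y :=
  show (t : ℝ) • (x : X) ≤ (t : ℝ) • (y : X) from
    smul_le_smul_of_nonneg_left (show (x : X) ≤ y from h) t.coe_nonneg

theorem PreservesSup.monotone_maxPolyMap {A : C → C} (hsup : PreservesSup A)
    (q : Polynomial ℝ≥0) : Monotone (maxPolyMap q A) := fun _ _ h =>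
  Finset.sup'_mono_fun fun j _ => nnreal_smul_mono ((hsup.iterate j).monotone h)

/-- For `t > 0`, scaling is an order automorphism with inverse scaling by `t⁻¹`; for `t = 0` both
sides vanish. -/
theorem nnreal_smul_sup (t : ℝ≥0) (x y : C) : t • (x ⊔ y) = t • x ⊔ t • y := by
  refine le_antisymm ?_ (sup_le (nnreal_smul_mono le_sup_left) (nnreal_smul_mono le_sup_right))
  rcases eq_or_ne t 0 with rfl | ht
  · refine le_trans (le_of_eq ?_) le_sup_left
    exact Subtype.ext (by simp [coe_nnreal_smul])
  · have h : ∀ z : C, t⁻¹ • t • z = z := fun z => Subtype.ext (by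
      simp [coe_nnreal_smul, smul_smul, ht])
    have h' : ∀ z : C, t • t⁻¹ • z = z := fun z => Subtype.ext (by
      simp [coe_nnreal_smul, smul_smul, ht])
    rw [← h' (t • x ⊔ t • y)]
    refine nnreal_smul_mono (sup_le ?_ ?_)
    · exact (h x).symm.le.trans (nnreal_smul_mono le_sup_left)
    · exact (h y).symm.le.trans (nnreal_smul_mono le_sup_right)

theorem PosHomogeneous.maxPolyMap {A : C → C} (hhom : PosHomogeneous A) (q : Polynomial ℝ≥0) :
    PosHomogeneous (maxPolyMap q A) := by
  intro t x
  unfold MaxCone.maxPolyMap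
  rw [Finset.apply_sup'_eq_sup'_comp _ (fun y : C => t • y) (nnreal_smul_sup t)]
  congr 1
  funext j
  rw [Function.comp_apply, hhom.iterate j]
  exact Subtype.ext (by simp only [coe_nnreal_smul]; rw [smul_comm])

/-- If `A ^ m x ≤ s ^ m u` for all `m ≤ k deg q`, then `q_∨(A) ^ k x ≤ q_∨(s) ^ k u`. -/
theorem iterate_maxPolyMap_le {A : C → C} (hhom : PosHomogeneous A) (hsup : PreservesSup A)
    (q : Polynomial ℝ≥0) {s : ℝ} (hs : 0 ≤ s) (k : ℕ) (x : C) {u : X} (hu : 0 ≤ u)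
    (h : ∀ m ≤ q.natDegree * k, (A^[m] x : X) ≤ s ^ m • u) :
    ((maxPolyMap q A)^[k] x : X) ≤ maxPolyEval q s ^ k • u := by
  induction k generalizing x u with
  | zero => simpa using h 0 (Nat.zero_le _)
  | succ k ih =>
    rw [Function.iterate_succ_apply, pow_succ, mul_smul]
    have hv : 0 ≤ maxPolyEval q s • u := smul_nonneg (maxPolyEval_nonneg q s) hu
    -- The induction hypothesis is applied to `q_∨(A) x` with majorant `q_∨(s) u`; `A ^ m` passes
    -- through the supremum, and each term is bounded separately.
    refine ih _ hv fun m hm => ?_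
    rw [iterate_maxPolyMap hhom hsup]
    refine Finset.sup'_induction (p := fun y : C => (y : X) ≤ s ^ m • maxPolyEval q s • u) _ _
      (fun y hy z hz => sup_le hy hz) fun j hj => ?_
    have hmj : m + j ≤ q.natDegree * (k + 1) := by
      rw [Nat.mul_succ]
      exact Nat.add_le_add hm (Nat.lt_succ_iff.1 (Finset.mem_range.1 hj))
    calc (q.coeff j : ℝ) • (A^[m + j] x : X) ≤ (q.coeff j : ℝ) • s ^ (m + j) • u :=
          smul_le_smul_of_nonneg_left (h _ hmj) (NNReal.coe_nonneg _)
      _ = s ^ m • ((q.coeff j : ℝ) * s ^ j) • u := by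
          simp only [smul_smul]
          congr 1
          ring
      _ ≤ s ^ m • maxPolyEval q s • u :=
          smul_le_smul_of_nonneg_left
            (smul_le_smul_of_nonneg_right (coeff_mul_pow_le_maxPolyEval q s hj) hu)
            (pow_nonneg hs m)

theorem coeff_pow_smul_iterate_le_iterate_maxPolyMap {A : C → C} (hhom : PosHomogeneous A)
    (hsup : PreservesSup A) (q : Polynomial ℝ≥0) {j : ℕ}
    (hj : j ∈ Finset.range (q.natDegree + 1)) (k : ℕ) (x : C) :
    (q.coeff j ^ k) • A^[j * k] x ≤ (MaxCone.maxPolyMap q A)^[k] x := by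
  induction k with
  | zero => exact le_of_eq (Subtype.ext (by simp [coe_nnreal_smul]))
  | succ k ih =>
    rw [Function.iterate_succ_apply']
    refine le_trans (le_of_eq ?_) ((coeff_smul_iterate_le_maxPolyMap q A _ hj).trans (hsup.monotone_maxPolyMap q ih))
    rw [(hhom.iterate j) _ _, ← Function.iterate_add_apply, Nat.mul_succ, Nat.add_comm j]
    exact Subtype.ext (by simp [coe_nnreal_smul, smul_smul, pow_succ'])

end Order

/-! ### Operator norms and the two spectral radius inequalities. -/

section Norm

variable {X : Type*} [NormedAddCommGroup X] [NormedSpace ℝ X] [Lattice X] {C : MaxCone X}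

theorem opNorm_nonneg (A : C → C) : 0 ≤ opNorm A := by
  refine Real.sSup_nonneg ?_
  rintro _ ⟨x, _, rfl⟩
  positivity

theorem bounded_of_norm_le {A : C → C} {c : ℝ} (h : ∀ x : C, ‖(A x : X)‖ ≤ c * ‖(x : X)‖) :
    Bounded A := by
  refine ⟨c, ?_⟩
  rintro _ ⟨x, hx, rfl⟩
  exact (div_le_iff₀ (norm_pos_iff.2 hx)).2 (h x)

theorem opNorm_le (hC : C.IsNonzero) {A : C → C} {c : ℝ}
    (h : ∀ x : C, ‖(A x : X)‖ ≤ c * ‖(x : X)‖) : opNorm A ≤ c := by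
  obtain ⟨x, hxC, hx⟩ := hC
  refine csSup_le ⟨_, ⟨x, hxC⟩, hx, rfl⟩ ?_
  rintro _ ⟨x, hx, rfl⟩
  exact (div_le_iff₀ (norm_pos_iff.2 hx)).2 (h x)

theorem norm_le_opNorm_mul {A : C → C} (hhom : PosHomogeneous A) (hA : Bounded A) (x : C) :
    ‖(A x : X)‖ ≤ opNorm A * ‖(x : X)‖ := by
  rcases eq_or_ne (x : X) 0 with hx | hx
  · simp [hx, hhom.coe_map_eq_zero hx]
  · exact (div_le_iff₀ (norm_pos_iff.2 hx)).1 (le_csSup hA ⟨x, hx, rfl⟩)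

theorem norm_iterate_le {A : C → C} {c : ℝ} (hc : 0 ≤ c)
    (h : ∀ x : C, ‖(A x : X)‖ ≤ c * ‖(x : X)‖) (m : ℕ) (x : C) :
    ‖(A^[m] x : X)‖ ≤ c ^ m * ‖(x : X)‖ := by
  induction m with
  | zero => simp
  | succ m ih =>
    rw [Function.iterate_succ_apply', pow_succ', mul_assoc]
    exact (h _).trans (mul_le_mul_of_nonneg_left ih hc)

theorem Bounded.iterate {A : C → C} (hhom : PosHomogeneous A) (hA : Bounded A) (m : ℕ) :
    Bounded A^[m] :=
  bounded_of_norm_le (norm_iterate_le (opNorm_nonneg A) (norm_le_opNorm_mul hhom hA) m)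

theorem opNorm_iterate_zero (hC : C.IsNonzero) (A : C → C) : opNorm A^[0] = 1 := by
  have h : ∀ x : C, ‖(A^[0] x : X)‖ ≤ 1 * ‖(x : X)‖ := fun x => by simp
  refine le_antisymm (opNorm_le hC h) ?_
  -- A nonzero vector is essential: over the empty set `sSup` would be `0`.
  obtain ⟨x, hxC, hx⟩ := hC
  refine le_csSup (bounded_of_norm_le h) ⟨⟨x, hxC⟩, hx, ?_⟩
  exact (div_self (norm_ne_zero_iff.2 hx)).symm

theorem opNorm_iterate_add_le (hC : C.IsNonzero) {A : C → C} (hhom : PosHomogeneous A)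
    (hA : Bounded A) (m n : ℕ) : opNorm A^[m + n] ≤ opNorm A^[m] * opNorm A^[n] := by
  refine opNorm_le hC fun x => ?_
  rw [Function.iterate_add_apply, mul_assoc]
  exact (norm_le_opNorm_mul (hhom.iterate m) (hA.iterate hhom m) _).trans
    (mul_le_mul_of_nonneg_left (norm_le_opNorm_mul (hhom.iterate n) (hA.iterate hhom n) x)
      (opNorm_nonneg _))

theorem bonsallRadius_spec (hC : C.IsNonzero) {A : C → C} (hhom : PosHomogeneous A)
    (hA : Bounded A) : 0 ≤ bonsallRadius A ∧
      Tendsto (rootNorm A) atTop (𝓝 (bonsallRadius A)) ∧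
      (∀ n, bonsallRadius A ^ n ≤ opNorm A^[n]) ∧
      ∀ s, bonsallRadius A < s → ∃ M : ℝ, 0 < M ∧ ∀ m, opNorm A^[m] ≤ M * s ^ m := by
  obtain ⟨r, h0, hr, hpow, hgrowth⟩ := exists_tendsto_rpow_one_div_of_submultiplicative
    (a := fun n => opNorm A^[n]) (fun _ => opNorm_nonneg _) (opNorm_iterate_zero hC A)
    (opNorm_iterate_add_le hC hhom hA)
  have hr' : bonsallRadius A = r := Tendsto.limUnder_eq hr
  rw [hr']
  exact ⟨h0, hr, hpow, hgrowth⟩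

theorem bounded_of_lipschitzWith {A : C → C} (hhom : PosHomogeneous A) {L : ℝ≥0}
    (hL : LipschitzWith L A) : Bounded A := by
  refine bounded_of_norm_le (c := L) fun x => ?_
  have h0 : (((0 : ℝ≥0) • x : C) : X) = 0 := by simp [coe_nnreal_smul]
  have h := hL.dist_le_mul x ((0 : ℝ≥0) • x)
  rwa [Subtype.dist_eq, Subtype.dist_eq, h0, hhom.coe_map_eq_zero h0, dist_zero_right,
    dist_zero_right] at h

variable [IsOrderedAddMonoid X] [IsOrderedModule ℝ X] [HasSolidNorm X]

/-- The majorant `u` is a sum formed in `X`, as `C` need not be convex. Each of its `k deg q + 1`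
terms has norm at most `M ‖x‖`. -/
theorem norm_iterate_maxPolyMap_le {A : C → C} (hhom : PosHomogeneous A) (hsup : PreservesSup A)
    (q : Polynomial ℝ≥0) {s M : ℝ} (hs : 0 < s)
    (h : ∀ (m : ℕ) (x : C), ‖(A^[m] x : X)‖ ≤ M * s ^ m * ‖(x : X)‖) (k : ℕ) (x : C) :
    ‖((maxPolyMap q A)^[k] x : X)‖ ≤
      (((q.natDegree * k + 1 : ℕ) : ℝ) * M) * maxPolyEval q s ^ k * ‖(x : X)‖ := by
  set N := q.natDegree * k + 1 with hN
  have hterm : ∀ m ∈ Finset.range N, 0 ≤ (s ^ m)⁻¹ • (A^[m] x : X) := fun m _ =>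
    smul_nonneg (by positivity) (coe_nonneg _)
  have hu := Finset.sum_nonneg hterm
  have hle := iterate_maxPolyMap_le hhom hsup q hs.le k x hu fun m hm => by
    have h1 := Finset.single_le_sum hterm (Finset.mem_range.2 (Nat.lt_succ_of_le hm))
    have h2 := smul_le_smul_of_nonneg_left h1 (pow_nonneg hs.le m)
    rwa [smul_inv_smul₀ (pow_pos hs m).ne'] at h2
  have hq : 0 ≤ maxPolyEval q s ^ k := pow_nonneg (maxPolyEval_nonneg q s) k
  have hsum : ‖∑ m ∈ Finset.range N, (s ^ m)⁻¹ • (A^[m] x : X)‖ ≤ N * (M * ‖(x : X)‖) := by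
    refine (norm_sum_le_of_le _ (f := fun m => (s ^ m)⁻¹ • (A^[m] x : X))
      (n := fun _ => M * ‖(x : X)‖) fun m _ => ?_).trans (by simp)
    rw [norm_smul, Real.norm_of_nonneg (by positivity), inv_mul_le_iff₀ (by positivity)]
    exact (h m x).trans_eq (by ring)
  calc ‖((maxPolyMap q A)^[k] x : X)‖
      ≤ ‖maxPolyEval q s ^ k • ∑ m ∈ Finset.range N, (s ^ m)⁻¹ • (A^[m] x : X)‖ :=
        norm_le_norm_of_nonneg_of_le (coe_nonneg _) hle
    _ = maxPolyEval q s ^ k * ‖∑ m ∈ Finset.range N, (s ^ m)⁻¹ • (A^[m] x : X)‖ := by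
        rw [norm_smul, Real.norm_of_nonneg hq]
    _ ≤ maxPolyEval q s ^ k * (N * (M * ‖(x : X)‖)) := mul_le_mul_of_nonneg_left hsum hq
    _ = _ := by ring

theorem Bounded.maxPolyMap {A : C → C} (hhom : PosHomogeneous A) (hsup : PreservesSup A)
    (hA : Bounded A) (q : Polynomial ℝ≥0) : Bounded (maxPolyMap q A) := by
  -- Case `k = 1` of the iterate estimate; the `+ 1` keeps `s` positive even if `‖A‖ = 0`.
  have h1 : ∀ x : C, ‖(A x : X)‖ ≤ (opNorm A + 1) * ‖(x : X)‖ := fun x =>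
    (norm_le_opNorm_mul hhom hA x).trans (by gcongr; linarith)
  have h0 : 0 < opNorm A + 1 := by linarith [opNorm_nonneg A]
  exact bounded_of_norm_le (norm_iterate_maxPolyMap_le hhom hsup q (M := 1) h0
    (fun m x => by simpa using norm_iterate_le h0.le h1 m x) 1)

theorem maxPolyEval_bonsallRadius_le (hC : C.IsNonzero) {A : C → C} (hhom : PosHomogeneous A)
    (hsup : PreservesSup A) (hA : Bounded A) (q : Polynomial ℝ≥0) :
    maxPolyEval q (bonsallRadius A) ≤ bonsallRadius (MaxCone.maxPolyMap q A) := by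
  obtain ⟨hr, -, hpow, -⟩ := bonsallRadius_spec hC hhom hA
  have hBhom := hhom.maxPolyMap q
  have hB := hA.maxPolyMap hhom hsup q
  refine Finset.sup'_le _ _ fun j hj => ge_of_tendsto (bonsallRadius_spec hC hBhom hB).2.1 ?_
  filter_upwards [eventually_ne_atTop 0] with k hk
  have hop : (q.coeff j : ℝ) ^ k * opNorm A^[j * k] ≤ opNorm (MaxCone.maxPolyMap q A)^[k] := by
    rcases eq_or_ne (q.coeff j) 0 with h0 | h0
    · simpa [h0, hk] using opNorm_nonneg _
    have hc : 0 < (q.coeff j : ℝ) ^ k := pow_pos (by positivity) k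
    rw [← le_div_iff₀' hc]
    refine opNorm_le hC fun x => ?_
    rw [div_mul_eq_mul_div, le_div_iff₀' hc]
    refine le_trans ?_ (norm_le_opNorm_mul (hBhom.iterate k) (hB.iterate hBhom k) x)
    have h := norm_le_norm_of_nonneg_of_le (coe_nonneg _)
      (coeff_pow_smul_iterate_le_iterate_maxPolyMap hhom hsup q hj k x)
    rwa [coe_nnreal_smul, norm_smul, Real.norm_of_nonneg (NNReal.coe_nonneg _),
      NNReal.coe_pow] at h
  have h : ((q.coeff j : ℝ) * bonsallRadius A ^ j) ^ k ≤
      opNorm (MaxCone.maxPolyMap q A)^[k] := by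
    rw [mul_pow, ← pow_mul]
    exact (mul_le_mul_of_nonneg_left (hpow _) (by positivity)).trans hop
  unfold rootNorm
  rw [one_div, Real.le_rpow_inv_iff_of_pos (by positivity) (opNorm_nonneg _) (by positivity),
    Real.rpow_natCast]
  exact h

theorem bonsallRadius_maxPolyMap_le (hC : C.IsNonzero) {A : C → C} (hhom : PosHomogeneous A)
    (hsup : PreservesSup A) (hA : Bounded A) (q : Polynomial ℝ≥0) :
    bonsallRadius (MaxCone.maxPolyMap q A) ≤ maxPolyEval q (bonsallRadius A) := by
  obtain ⟨hr, -, -, hgrowth⟩ := bonsallRadius_spec hC hhom hA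
  have hlim := (bonsallRadius_spec hC (hhom.maxPolyMap q) (hA.maxPolyMap hhom hsup q)).2.1
  -- The growth bound holds only for `s > r(A)`, so the limit is taken from the right.
  refine ge_of_tendsto ((continuous_maxPolyEval q).continuousWithinAt
    (s := Set.Ioi (bonsallRadius A)) (x := bonsallRadius A)) ?_
  filter_upwards [self_mem_nhdsWithin] with s hs
  have hs0 : 0 < s := hr.trans_lt hs
  obtain ⟨M, hM, hbound⟩ := hgrowth s hs
  -- `K` comes from `k deg q + 1 ≤ (deg q + 1) k` for `k ≥ 1`.
  refine le_of_tendsto_rpow_one_div (fun _ => opNorm_nonneg _) hlim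
    (K := (q.natDegree + 1) * M) (by positivity) (maxPolyEval_nonneg q s) fun k hk => ?_
  refine (opNorm_le hC (norm_iterate_maxPolyMap_le hhom hsup q hs0 (fun m x =>
    (norm_le_opNorm_mul (hhom.iterate m) (hA.iterate hhom m) x).trans
      (mul_le_mul_of_nonneg_right (hbound m) (norm_nonneg _))) k)).trans ?_
  refine mul_le_mul_of_nonneg_right ?_ (pow_nonneg (maxPolyEval_nonneg q s) k)
  have hk1 : (1 : ℝ) ≤ k := by exact_mod_cast Nat.one_le_iff_ne_zero.2 hk
  push_cast
  nlinarith

end Norm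

end MaxCone

/-- `X` is a normed vector lattice, `C` a nonzero max-cone in `X`, and `A` a Lipschitz, positively
homogeneous map preserving finite suprema. The first conjuncts say that both radii in the final
equality are well defined, as actual limits. -/
theorem corollary4p8 {X : Type*} [NormedAddCommGroup X] [NormedSpace ℝ X] [Lattice X]
    [IsOrderedAddMonoid X] [IsOrderedModule ℝ X] [HasSolidNorm X]
    (C : MaxCone X) (hC : C.IsNonzero) (A : C → C)
    (hLip : ∃ L : ℝ≥0, LipschitzWith L A)
    (hhom : MaxCone.PosHomogeneous A) (hsup : MaxCone.PreservesSup A)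
    (q : Polynomial ℝ≥0) :
    MaxCone.Bounded A ∧
    MaxCone.PosHomogeneous (MaxCone.maxPolyMap q A) ∧
    MaxCone.Bounded (MaxCone.maxPolyMap q A) ∧
    Tendsto (MaxCone.rootNorm A) atTop (𝓝 (MaxCone.bonsallRadius A)) ∧
    Tendsto (MaxCone.rootNorm (MaxCone.maxPolyMap q A)) atTop
      (𝓝 (MaxCone.bonsallRadius (MaxCone.maxPolyMap q A))) ∧
    MaxCone.bonsallRadius (MaxCone.maxPolyMap q A) = maxPolyEval q (MaxCone.bonsallRadius A) := by
  obtain ⟨L, hL⟩ := hLip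
  have hA := MaxCone.bounded_of_lipschitzWith hhom hL
  have hBhom := hhom.maxPolyMap q
  have hB := hA.maxPolyMap hhom hsup q
  exact ⟨hA, hBhom, hB, (MaxCone.bonsallRadius_spec hC hhom hA).2.1,
    (MaxCone.bonsallRadius_spec hC hBhom hB).2.1,
    le_antisymm (MaxCone.bonsallRadius_maxPolyMap_le hC hhom hsup hA q)
      (MaxCone.maxPolyEval_bonsallRadius_le hC hhom hsup hA q)⟩
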